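/- Let $\mathcal G$ be a weighted directed graph on $\{1,\dots,N\}$ with nonnegative weights $a_{ij}$ ($(j,i)$ is an edge iff $a_{ij}>0$) that is strongly connected and weight-balanced, i.e. $\sum_j a_{ij}=\sum_j a_{ji}=:d_i$ for all $i$, and let $L=\mathrm{diag}(d_1,\dots,d_N)-[a_{ij}]$ be its Laplacian. For each $i$ let $\Omega_i\subseteq\mathbb R^{n_i}$ be closed and convex, and let $f_i:\Omega_i\to\mathbb R$ and $g_i:\Omega_i\to\mathbb R^p$ be differentiable over $\Omega_i$, such that, for constants $\mu_f,\kappa_f,\kappa_g>0$ common to all $i$: * $(x-y)^T(\nabla f_i(x)-\nabla f_i(y))\ge\mu_f\|x-y\|^2$ for all $x,y\in\Omega_i$ (strong convexity), and $\nabla f_i$ is $\kappa_f$-Lipschitz on $\Omega_i$; * each component of $g_i$ is convex on $\Omega_i$, $g_i$ is $\kappa_g$-Lipschitz on $\Omega_i$, and $\nabla g_i$ (the transposed Jacobian) is locally Lipschitz on $\Omega_i$; * (Slater) with $\boldsymbol\Omega=\Omega_1\times\dots\times\Omega_N$, there is $\tilde{\boldsymbol x}$ in the relative interior of $\boldsymbol\Omega$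 with $\sum_i g_i(\tilde x_i)<\mathbf 0$ componentwise. All norms are Euclidean. For $u\in\mathbb R^N$ let $S(u)=\{z\in\mathbb R^N : z\ge\mathbf 0,\ Lz-u\ge\mathbf 0,\ z^T(Lz-u)=0\}$, the solution set of the linear complementarity problem $\mathrm{LCP}(-u,L)$. Then: 1. There is a constant $\kappa_L>0$ such that $S$ has a $\kappa_L$-Lipschitz single-valued selection on the half-space $\{u\in\mathbb R^N:\mathbf 1^Tu\le 0\}$. 2. For every $\kappa_L>0$ with the property in 1 and every $\varepsilon\in(0,\varepsilon^*)$, where $\varepsilon^*=\dfrac{\mu_f}{\kappa_g^2\kappa_L}$, the dynamics $$\dot{\boldsymbol x}=P_{\boldsymbol\Omega}\big(\boldsymbol x-\nabla f(\boldsymbol x)-\boldsymbol v(\boldsymbol x,\boldsymbol\lambda)\big)-\boldsymbol x,\qquad \varepsilon\dot{\boldsymbol\lambda}=P_{\mathbb R^{pN}_+}\big(\varepsilon\boldsymbol\lambda+\varepsilon\boldsymbol u(\boldsymbol x)-(L\otimes I_p)\boldsymbol\lambda\big)-\varepsilon\boldsymbol\lambda$$ has an equilibrium $(\boldsymbol x^*_\varepsilon,\boldsymbol\lambda^*_\varepsilon)$,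 i.e. a point at which both right-hand sides vanish. Here $P_C$ is the Euclidean projection onto $C$, $\boldsymbol x=(x_1,\dots,x_N)$ with $x_i\in\mathbb R^{n_i}$, $\boldsymbol\lambda=(\lambda_1,\dots,\lambda_N)$ with $\lambda_i\in\mathbb R^p$, $\nabla f(\boldsymbol x)=(\nabla f_i(x_i))_i$, $\boldsymbol u(\boldsymbol x)=(g_i(x_i))_i$ and $\boldsymbol v(\boldsymbol x,\boldsymbol\lambda)=(\nabla g_i(x_i)\lambda_i)_i$. -/

import Mathlib

open scoped NNReal Matrix

noncomputable section

/-- The Euclidean projection `P_C(x) = argmin_{y ∈ C} ‖x - y‖`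
(meaningful when `C` is nonempty, closed and convex, see `metricProj_eq_iff`). -/
def metricProj {E : Type*} [NormedAddCommGroup E] (C : Set E) (x : E) : E :=
  Classical.epsilon fun y => y ∈ C ∧ ∀ z ∈ C, ‖x - y‖ ≤ ‖x - z‖

theorem metricProj_eq_iff {E : Type*} [NormedAddCommGroup E] [InnerProductSpace ℝ E]
    [CompleteSpace E] {C : Set E} (hne : C.Nonempty) (hcl : IsClosed C) (hcv : Convex ℝ C)
    (x y : E) : metricProj C x = y ↔ y ∈ C ∧ ∀ z ∈ C, ‖x - y‖ ≤ ‖x - z‖ := by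
  have key : ∀ w ∈ C, (∀ z ∈ C, ‖x - w‖ ≤ ‖x - z‖) → ∀ z ∈ C, inner ℝ (x - w) (z - w) ≤ 0 := by
    intro w hw h
    have : Nonempty C := ⟨⟨w, hw⟩⟩
    refine (norm_eq_iInf_iff_real_inner_le_zero hcv hw).1 (le_antisymm ?_ ?_)
    · exact le_ciInf fun z => h z z.2
    · exact ciInf_le ⟨0, by rintro _ ⟨z, rfl⟩; exact norm_nonneg _⟩ (⟨w, hw⟩ : C)
  have hex : ∃ w, w ∈ C ∧ ∀ z ∈ C, ‖x - w‖ ≤ ‖x - z‖ := by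
    obtain ⟨w, hw, h⟩ := exists_norm_eq_iInf_of_complete_convex hne hcl.isComplete hcv x
    refine ⟨w, hw, fun z hz => ?_⟩
    rw [h]
    exact ciInf_le ⟨0, by rintro _ ⟨z, rfl⟩; exact norm_nonneg _⟩ (⟨z, hz⟩ : C)
  have hP : metricProj C x ∈ C ∧ ∀ z ∈ C, ‖x - metricProj C x‖ ≤ ‖x - z‖ :=
    Classical.epsilon_spec hex
  constructor
  · rintro rfl
    exact hP
  · rintro ⟨hy, h⟩
    have h1 := key _ hy h _ hP.1
    have h2 := key _ hP.1 hP.2 _ hy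
    generalize metricProj C x = w at *
    have h3 : inner ℝ (w - y) (w - y) ≤ 0 := by
      have e : inner ℝ (w - y) (w - y) = inner ℝ (x - y) (w - y) + inner ℝ (x - w) (y - w) := by
        rw [← neg_sub w y, inner_neg_right, ← sub_eq_add_neg, ← inner_sub_left]
        congr 1
        abel
      linarith
    exact sub_eq_zero.1 (inner_self_eq_zero.1 (le_antisymm h3 real_inner_self_nonneg))

/-- A weighted directed graph on `{0, …, N-1}`, given by its nonnegative weight matrix `[a_ij]`. -/
structure WeightedDigraph (N : ℕ) where
  weight : Matrix (Fin N) (Fin N) ℝ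
  weight_nonneg : ∀ i j, 0 ≤ weight i j

namespace WeightedDigraph

variable {N : ℕ} (G : WeightedDigraph N)

/-- `(j, i)` is an edge, i.e. `j` is an in-neighbor of `i`, iff `a_ij > 0`. -/
def Edge (j i : Fin N) : Prop := 0 < G.weight i j

def StronglyConnected : Prop := ∀ i j, Relation.ReflTransGen G.Edge i j

def WeightBalanced : Prop := ∀ i, ∑ j, G.weight i j = ∑ j, G.weight j i

/-- The Laplacian `L = D - A`, `D = diag(d_1, …, d_N)`, `d_i = ∑_j a_ij`. -/
def laplacian : Matrix (Fin N) (Fin N) ℝ :=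
  Matrix.diagonal (fun i => ∑ j, G.weight i j) - G.weight

end WeightedDigraph

/-- The solution set of the linear complementarity problem `LCP(q, M)`:
`z ≥ 0`, `q + M z ≥ 0`, `zᵀ (q + M z) = 0`. -/
def lcpSol {N : ℕ} (q : EuclideanSpace ℝ (Fin N)) (M : Matrix (Fin N) (Fin N) ℝ) :
    Set (EuclideanSpace ℝ (Fin N)) :=
  {z | (∀ i, 0 ≤ z i) ∧ (∀ i, 0 ≤ q i + (M *ᵥ z.ofLp) i) ∧
    ∑ i, z i * (q i + (M *ᵥ z.ofLp) i) = 0}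

/-- `κ` is a Lipschitz constant (for the Euclidean norm) of a single-valued selection of
`u ↦ SOL(-u, L)` over the half-space `{u | 1ᵀ u ≤ 0}`. -/
def IsLCPLipschitzConst {N : ℕ} (L : Matrix (Fin N) (Fin N) ℝ) (κ : ℝ≥0) : Prop :=
  ∃ S : EuclideanSpace ℝ (Fin N) → EuclideanSpace ℝ (Fin N),
    (∀ u, ∑ i, u i ≤ 0 → S u ∈ lcpSol (-u) L) ∧ LipschitzOnWith κ S {u | ∑ i, u i ≤ 0}

/-- The stacked decision space `ℝ^{n_1} × ⋯ × ℝ^{n_N}` with the Euclidean norm. -/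
abbrev DecisionSpace {N : ℕ} (n : Fin N → ℕ) : Type :=
  PiLp 2 fun i => EuclideanSpace ℝ (Fin (n i))

/-- The stacked multiplier space `(ℝ^p)^N` with the Euclidean norm. -/
abbrev MultiplierSpace (N p : ℕ) : Type :=
  PiLp 2 fun _ : Fin N => EuclideanSpace ℝ (Fin p)

/-- The data of a distributed resource allocation problem: a network, local feasible sets
`Ω_i ⊆ ℝ^{n_i}`, costs `f_i` and resource maps `g_i` (only their values on `Ω_i` matter), with
gradient maps `gradf i` and Jacobian maps `jacg i`. That these are the derivatives of `f i`, `g i`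
over `Ω_i` is part of `StandingAssumption`. -/
structure ResourceProblem (N p : ℕ) (n : Fin N → ℕ) where
  graph : WeightedDigraph N
  Ω : ∀ i, Set (EuclideanSpace ℝ (Fin (n i)))
  f : ∀ i, EuclideanSpace ℝ (Fin (n i)) → ℝ
  gradf : ∀ i, EuclideanSpace ℝ (Fin (n i)) → EuclideanSpace ℝ (Fin (n i))
  g : ∀ i, EuclideanSpace ℝ (Fin (n i)) → EuclideanSpace ℝ (Fin p)
  jacg : ∀ i, EuclideanSpace ℝ (Fin (n i)) →
    (EuclideanSpace ℝ (Fin (n i)) →L[ℝ] EuclideanSpace ℝ (Fin p))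

namespace ResourceProblem

variable {N p : ℕ} {n : Fin N → ℕ} (P : ResourceProblem N p n)

/-- `Ω = Ω_1 × ⋯ × Ω_N`. -/
def feasible : Set (DecisionSpace n) := {x | ∀ i, x i ∈ P.Ω i}

/-- `g(x) = g_1(x_1) + ⋯ + g_N(x_N)`. -/
def totalResource (x : DecisionSpace n) : EuclideanSpace ℝ (Fin p) := ∑ i, P.g i (x i)

/-- `∇f(x) = col(∇f_1(x_1), …, ∇f_N(x_N))`. -/
def gradTotalCost (x : DecisionSpace n) : DecisionSpace n :=
  WithLp.toLp 2 fun i => P.gradf i (x i)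

/-- `u(x) = col(g_1(x_1), …, g_N(x_N))`. -/
def stackedResource (x : DecisionSpace n) : MultiplierSpace N p :=
  WithLp.toLp 2 fun i => P.g i (x i)

/-- `v(x, λ) = col(∇g_1(x_1) λ_1, …, ∇g_N(x_N) λ_N)`, where `∇g_i` is the transposed Jacobian. -/
def stackedGradResource (x : DecisionSpace n) (l : MultiplierSpace N p) : DecisionSpace n :=
  WithLp.toLp 2 fun i => ContinuousLinearMap.adjoint (P.jacg i (x i)) (l i)

/-- `(L ⊗ I_p) λ`. -/
def bigLaplacian (l : MultiplierSpace N p) : MultiplierSpace N p :=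
  WithLp.toLp 2 fun i => ∑ j, P.graph.laplacian i j • l j

/-- The assumptions on the problem, with their constants `μ_f`, `κ_f`, `κ_g`. -/
structure StandingAssumption (μf : ℝ) (κf κg : ℝ≥0) : Prop where
  μf_pos : 0 < μf
  κf_pos : 0 < κf
  κg_pos : 0 < κg
  hasGradient_f : ∀ i, ∀ x ∈ P.Ω i, HasGradientWithinAt (P.f i) (P.gradf i x) (P.Ω i) x
  stronglyConvex_f : ∀ i, ∀ x ∈ P.Ω i, ∀ y ∈ P.Ω i,
    μf * ‖x - y‖ ^ 2 ≤ inner ℝ (x - y) (P.gradf i x - P.gradf i y)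
  lipschitz_gradf : ∀ i, LipschitzOnWith κf (P.gradf i) (P.Ω i)
  isClosed_Ω : ∀ i, IsClosed (P.Ω i)
  convex_Ω : ∀ i, Convex ℝ (P.Ω i)
  hasFDeriv_g : ∀ i, ∀ x ∈ P.Ω i, HasFDerivWithinAt (P.g i) (P.jacg i x) (P.Ω i) x
  convex_g : ∀ i k, ConvexOn ℝ (P.Ω i) fun x => P.g i x k
  lipschitz_g : ∀ i, LipschitzOnWith κg (P.g i) (P.Ω i)
  locallyLipschitz_jacg : ∀ i, LocallyLipschitzOn (P.Ω i) (P.jacg i)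
  slater : ∃ x ∈ intrinsicInterior ℝ P.feasible, ∀ k, P.totalResource x k < 0
  stronglyConnected : P.graph.StronglyConnected
  weightBalanced : P.graph.WeightBalanced

/-- The nonnegative orthant `ℝ^{pN}_+`. -/
def orthant (N p : ℕ) : Set (MultiplierSpace N p) := {l | ∀ i k, 0 ≤ l i k}

/-- Right-hand side of `ẋ = P_Ω(x - ∇f(x) - v(x, λ)) - x`. -/
def primalFlow (x : DecisionSpace n) (l : MultiplierSpace N p) : DecisionSpace n :=
  metricProj P.feasible (x - P.gradTotalCost x - P.stackedGradResource x l) - x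

/-- Right-hand side of `ε λ̇ = P_{ℝ^{pN}_+}(ε λ + ε u(x) - (L ⊗ I_p) λ) - ε λ`. -/
def dualFlow (ε : ℝ) (x : DecisionSpace n) (l : MultiplierSpace N p) : MultiplierSpace N p :=
  metricProj (orthant N p) (ε • l + ε • P.stackedResource x - P.bigLaplacian l) - ε • l

/-- `(x, λ)` is an equilibrium of the dynamics `ẋ = primalFlow x λ`, `ε λ̇ = dualFlow ε x λ`. -/
def IsEquilibrium (ε : ℝ) (x : DecisionSpace n) (l : MultiplierSpace N p) : Prop :=
  P.primalFlow x l = 0 ∧ P.dualFlow ε x l = 0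

end ResourceProblem

end

noncomputable section

/-! ### The Laplacian of a weight-balanced graph: quadratic form, kernel and range. -/

namespace WeightedDigraph

variable {N : ℕ} (G : WeightedDigraph N)

/-! Lipschitz selection. Weight balance turns the quadratic form of `L` into half the weighted sum
of the `(x i - x j) ^ 2`, so by strong connectivity it is coercive on vectors with a zero
coordinate. A feasible point of the LCP of minimal coordinate sum is a solution with a zero
coordinate. For two such solutions `z`, `w`, the positive part of `z - w` vanishes where `z` does;
as the off-diagonal entries of `L` are nonpositive, complementarity bounds its quadratic form by its
inner product with the difference of the data (`norm_posPart_sub_le`).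

Equilibrium. At an equilibrium each multiplier vector solves an LCP with data `ε` times one slice of
the resource use. Since `L` kills constants, the ansatz is `λ^k = ε S(u^k(x)) + η_k 1`, where `S`
requires the total resource use to be nonpositive. On the set `coupledFeasible` so defined, the
field `∇f(x) + v(x, ε S(u(x)))` is strongly monotone with modulus `μf - ε κL κg ^ 2`: convexity of
`g` reduces the `v` part to an inner product of multiplier and resource differences, which the
Lipschitz bound on `S` controls (`stronglyMonotone_selectedField`). For `ε < ε*` its variational
inequality has a solution `x` (`exists_variationalInequality`). Then `x` minimizes a linear function
over `coupledFeasible`, and Slater's condition yields the multipliers `η`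
(`exists_lagrange_multiplier`). -/

theorem laplacian_mulVec_apply (x : Fin N → ℝ) (i : Fin N) :
    (G.laplacian *ᵥ x) i = ∑ j, G.weight i j * (x i - x j) := by
  simp only [laplacian, Matrix.sub_mulVec, Pi.sub_apply, Matrix.mulVec_diagonal, mul_sub,
    Finset.sum_sub_distrib, Finset.sum_mul]
  rfl

/-- This invariance lets LCP solutions be shifted: to make a vector nonnegative, to create a zero
coordinate, and to add a common Lagrange multiplier at every node. -/
theorem laplacian_mulVec_add_const (x : Fin N → ℝ) (c : ℝ) :
    G.laplacian *ᵥ (fun i => x i + c) = G.laplacian *ᵥ x := by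
  ext i
  simp [laplacian_mulVec_apply]

variable {G}

theorem WeightBalanced.sum_laplacian_mulVec (hG : G.WeightBalanced) (x : Fin N → ℝ) :
    ∑ i, (G.laplacian *ᵥ x) i = 0 := by
  simp only [laplacian_mulVec_apply, mul_sub, Finset.sum_sub_distrib]
  rw [Finset.sum_comm (f := fun i j => G.weight i j * x j)]
  simp only [← Finset.sum_mul, hG _, sub_self]

theorem WeightBalanced.dotProduct_laplacian_mulVec (hG : G.WeightBalanced) (x : Fin N → ℝ) :
    x ⬝ᵥ (G.laplacian *ᵥ x) = (∑ i, ∑ j, G.weight i j * (x i - x j) ^ 2) / 2 := by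
  -- Balance applied to the squares kills the last term of `(a - b) ^ 2 = 2 * a * (a - b) - (a ^ 2 -
  -- b ^ 2)` after weighted summation.
  have h := hG.sum_laplacian_mulVec (fun i => x i ^ 2)
  simp only [laplacian_mulVec_apply] at h
  have e : ∑ i, ∑ j, G.weight i j * (x i - x j) ^ 2 =
      2 * x ⬝ᵥ (G.laplacian *ᵥ x) - ∑ i, ∑ j, G.weight i j * (x i ^ 2 - x j ^ 2) := by
    simp only [dotProduct, laplacian_mulVec_apply, Finset.mul_sum, ← Finset.sum_sub_distrib]
    refine Finset.sum_congr rfl fun i _ => Finset.sum_congr rfl fun j _ => ?_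
    ring
  rw [e, h]
  ring

theorem WeightBalanced.dotProduct_laplacian_mulVec_nonneg (hG : G.WeightBalanced)
    (x : Fin N → ℝ) : 0 ≤ x ⬝ᵥ (G.laplacian *ᵥ x) := by
  rw [hG.dotProduct_laplacian_mulVec]
  have := Finset.sum_nonneg fun i (_ : i ∈ Finset.univ) => Finset.sum_nonneg
    fun j (_ : j ∈ Finset.univ) => mul_nonneg (G.weight_nonneg i j) (sq_nonneg (x i - x j))
  positivity

/-- The quadratic form of the Laplacian vanishes only on constant vectors. -/
theorem WeightBalanced.eq_of_dotProduct_laplacian_mulVec_eq_zero (hG : G.WeightBalanced)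
    (hc : G.StronglyConnected) {x : Fin N → ℝ} (hx : x ⬝ᵥ (G.laplacian *ᵥ x) = 0)
    (i j : Fin N) : x i = x j := by
  have hnn : ∀ i j, 0 ≤ G.weight i j * (x i - x j) ^ 2 := fun i j =>
    mul_nonneg (G.weight_nonneg i j) (sq_nonneg _)
  rw [hG.dotProduct_laplacian_mulVec, div_eq_zero_iff, or_iff_left (by norm_num),
    Finset.sum_eq_zero_iff_of_nonneg fun i _ => Finset.sum_nonneg fun j _ => hnn i j] at hx
  have hedge : ∀ a b, G.Edge a b → x a = x b := by
    intro a b hab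
    have h := (Finset.sum_eq_zero_iff_of_nonneg fun j _ => hnn b j).1
      (hx b (Finset.mem_univ _)) a (Finset.mem_univ _)
    rcases mul_eq_zero.1 h with h | h
    · exact absurd h (ne_of_gt hab)
    · linarith [pow_eq_zero_iff two_ne_zero |>.1 h]
  induction hc i j with
  | refl => rfl
  | tail _ hab ih => exact ih.trans (hedge _ _ hab)

/-- The quadratic form of the Laplacian is coercive on vectors that vanish at some node. -/
theorem WeightBalanced.exists_coercive (hG : G.WeightBalanced) (hc : G.StronglyConnected) :
    ∃ c > 0, ∀ x : EuclideanSpace ℝ (Fin N), (∃ i, x i = 0) →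
      c * ‖x‖ ^ 2 ≤ x.ofLp ⬝ᵥ (G.laplacian *ᵥ x.ofLp) := by
  let q : EuclideanSpace ℝ (Fin N) → ℝ := fun x => x.ofLp ⬝ᵥ (G.laplacian *ᵥ x.ofLp)
  have hq : Continuous q := by
    simp only [q, dotProduct, laplacian_mulVec_apply]
    fun_prop
  -- The product encodes a vanishing coordinate as a closed condition, so `T` is compact.
  let T : Set (EuclideanSpace ℝ (Fin N)) := Metric.sphere 0 1 ∩ {x | ∏ i, x i = 0}
  have hT : IsCompact T := (isCompact_sphere _ _).inter_right
    (isClosed_eq (by fun_prop) continuous_const)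
  have hpos : ∀ x ∈ T, 0 < q x := by
    rintro x ⟨hx1, hx0⟩
    refine lt_of_le_of_ne (hG.dotProduct_laplacian_mulVec_nonneg _) fun h => ?_
    obtain ⟨i, -, hi⟩ := Finset.prod_eq_zero_iff.1 hx0
    have : x = 0 := by
      ext j
      rw [hG.eq_of_dotProduct_laplacian_mulVec_eq_zero hc h.symm j i, hi]
      rfl
    simp [this] at hx1
  obtain ⟨c, hc0, hcT⟩ : ∃ c > 0, ∀ x ∈ T, c ≤ q x := by
    rcases T.eq_empty_or_nonempty with h | h
    · exact ⟨1, one_pos, by simp [h]⟩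
    · obtain ⟨x, hx, hmin⟩ := hT.exists_isMinOn h hq.continuousOn
      exact ⟨q x, hpos x hx, fun y hy => hmin hy⟩
  refine ⟨c, hc0, fun x ⟨i, hi⟩ => ?_⟩
  rcases eq_or_ne x 0 with rfl | hx
  · simp
  have hx' : ‖x‖ ≠ 0 := norm_ne_zero_iff.2 hx
  have h := hcT (‖x‖⁻¹ • x) ⟨by simp [norm_smul, hx'],
    Finset.prod_eq_zero (Finset.mem_univ i) (by simp [hi])⟩
  have e : q (‖x‖⁻¹ • x) = (‖x‖ ^ 2)⁻¹ * q x := by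
    simp only [q, WithLp.ofLp_smul, Matrix.mulVec_smul, dotProduct_smul, smul_dotProduct,
      smul_eq_mul]
    ring
  rw [e, inv_mul_eq_div, le_div_iff₀ (by positivity)] at h
  exact h

/-- The range of the Laplacian is the space of vectors with zero sum. -/
theorem WeightBalanced.exists_laplacian_mulVec_eq (hG : G.WeightBalanced)
    (hc : G.StronglyConnected) {v : Fin N → ℝ} (hv : ∑ i, v i = 0) :
    ∃ z, G.laplacian *ᵥ z = v := by
  rcases Nat.eq_zero_or_pos N with rfl | hN
  · exact ⟨0, Subsingleton.elim _ _⟩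
  have hN' : (N : ℝ) ≠ 0 := by positivity
  -- Adding the all-ones matrix to `L` removes the kernel of constants, and the two maps agree on
  -- preimages of zero-sum vectors.
  let M : (Fin N → ℝ) →ₗ[ℝ] (Fin N → ℝ) :=
    { toFun := fun z i => (G.laplacian *ᵥ z) i + ∑ j, z j
      map_add' := by
        intro x y
        ext i
        simp only [Matrix.mulVec_add, Pi.add_apply, Finset.sum_add_distrib]
        ring
      map_smul' := by
        intro a x
        ext i
        simp [Matrix.mulVec_smul, mul_add, Finset.mul_sum] }
  have hsum : ∀ z, ∑ i, M z i = N * ∑ j, z j := by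
    intro z
    simp [M, Finset.sum_add_distrib, hG.sum_laplacian_mulVec]
  have hM : ∀ z, ∑ i, M z i = 0 → M z = G.laplacian *ᵥ z ∧ ∑ j, z j = 0 := by
    intro z hz
    have h0 : ∑ j, z j = 0 := by
      rw [hsum] at hz
      exact (mul_eq_zero.1 hz).resolve_left hN'
    refine ⟨?_, h0⟩
    ext i
    simp [M, h0]
  have hinj : Function.Injective M := by
    refine (injective_iff_map_eq_zero M).2 fun z hz => ?_
    obtain ⟨h1, h2⟩ := hM z (by simp [hz])
    have h3 : z ⬝ᵥ (G.laplacian *ᵥ z) = 0 := by rw [← h1, hz]; simp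
    have h4 := hG.eq_of_dotProduct_laplacian_mulVec_eq_zero hc h3
    ext i
    have h5 : ∑ j, z j = N * z i := by
      rw [Finset.sum_congr rfl fun j _ => h4 j i]
      simp
    rw [h2] at h5
    exact (mul_eq_zero.1 h5.symm).resolve_left hN'
  obtain ⟨z, hz⟩ := LinearMap.injective_iff_surjective.1 hinj v
  exact ⟨z, by rw [← (hM z (by rw [hz, hv])).1, hz]⟩

/-! ### The linear complementarity problem of the Laplacian and its Lipschitz selection. -/

/-- A feasible point of minimal sum solves the complementarity problem and vanishes somewhere. -/
theorem WeightBalanced.exists_mem_lcpSol (hG : G.WeightBalanced) (hc : G.StronglyConnected)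
    (hN : 0 < N) {u : EuclideanSpace ℝ (Fin N)} (hu : ∑ i, u i ≤ 0) :
    ∃ z ∈ lcpSol (-u) G.laplacian, ∃ i, z i = 0 := by
  have : Nonempty (Fin N) := ⟨⟨0, hN⟩⟩
  have hNR : (0 : ℝ) < N := by positivity
  let C : Set (Fin N → ℝ) := {z | (∀ i, 0 ≤ z i) ∧ ∀ i, u i ≤ (G.laplacian *ᵥ z) i}
  have hCcl : IsClosed C := by
    have : C = (⋂ i, {z | 0 ≤ z i}) ∩ ⋂ i, {z | u i ≤ (G.laplacian *ᵥ z) i} := by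
      ext z
      simp [C]
    rw [this]
    refine (isClosed_iInter fun i => isClosed_le continuous_const (by fun_prop)).inter
      (isClosed_iInter fun i => isClosed_le continuous_const ?_)
    simp only [laplacian_mulVec_apply]
    fun_prop
  -- Solve `L z = u - mean(u)`; the mean is nonpositive, so `L z ≥ u`, and a constant shift makes
  -- `z` nonnegative.
  obtain ⟨z₀, hz₀⟩ : C.Nonempty := by
    obtain ⟨z, hz⟩ := hG.exists_laplacian_mulVec_eq hc
      (v := fun i => u i - (∑ j, u j) / N) (by
        rw [Finset.sum_sub_distrib]
        simp
        field_simp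
        simp)
    refine ⟨fun i => z i + ∑ j, |z j|, fun i => ?_, fun i => ?_⟩
    · have := Finset.single_le_sum (f := fun j => |z j|) (fun j _ => abs_nonneg _)
        (Finset.mem_univ i)
      have := neg_abs_le (z i)
      simp only at *
      linarith
    · rw [laplacian_mulVec_add_const, hz]
      have := div_nonpos_of_nonpos_of_nonneg hu hNR.le
      simp only
      linarith
  have hcomp : IsCompact (C ∩ {z | ∑ i, z i ≤ ∑ i, z₀ i}) := by
    refine (isCompact_Icc (a := (0 : Fin N → ℝ)) (b := fun _ => ∑ i, z₀ i)).of_isClosed_subset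
      (hCcl.inter (isClosed_le (by fun_prop) continuous_const)) ?_
    rintro z ⟨hz, hzs⟩
    exact ⟨hz.1, fun i => (Finset.single_le_sum (fun j _ => hz.1 j) (Finset.mem_univ i)).trans hzs⟩
  obtain ⟨z, ⟨hzC, hzs⟩, hmin'⟩ := hcomp.exists_isMinOn
    ⟨z₀, hz₀, show ∑ i, z₀ i ≤ ∑ i, z₀ i from le_rfl⟩
    (f := fun z : Fin N → ℝ => ∑ i, z i) (by fun_prop)
  have hmin : ∀ y ∈ C, ∑ i, z i ≤ ∑ i, y i := by
    intro y hy
    by_contra! h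
    exact absurd (hmin' ⟨hy, h.le.trans hzs⟩) (not_le.2 h)
  -- If both factors were positive, `z i` could be lowered slightly: the other components of `L z`
  -- do not decrease, and the sum drops.
  have hcompl : ∀ i, z i * ((G.laplacian *ᵥ z) i - u i) = 0 := by
    intro i
    by_contra hne
    have hzi : 0 < z i := lt_of_le_of_ne (hzC.1 i) fun h => hne (by simp [← h])
    have hwi : u i < (G.laplacian *ᵥ z) i :=
      lt_of_le_of_ne (hzC.2 i) fun h => hne (by simp [← h])
    let d := ∑ j, G.weight i j
    have hd : 0 ≤ d := Finset.sum_nonneg fun j _ => G.weight_nonneg i j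
    obtain ⟨t, ht0, htz, htw⟩ : ∃ t > 0, t ≤ z i ∧ t * d ≤ (G.laplacian *ᵥ z) i - u i := by
      -- `d + 1` replaces `d`, which may be zero.
      refine ⟨min (z i) (((G.laplacian *ᵥ z) i - u i) / (d + 1)),
        lt_min hzi (div_pos (by linarith) (by linarith)), min_le_left _ _, ?_⟩
      calc _ ≤ ((G.laplacian *ᵥ z) i - u i) / (d + 1) * (d + 1) :=
            mul_le_mul (min_le_right _ _) (by linarith) hd (div_nonneg (by linarith) (by linarith))
        _ = _ := div_mul_cancel₀ _ (by linarith)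
    have hy : (fun j => z j - if j = i then t else 0) ∈ C := by
      refine ⟨fun j => ?_, fun j => ?_⟩
      · beta_reduce
        split_ifs with h
        · subst h; linarith
        · simpa using hzC.1 j
      · rw [laplacian_mulVec_apply]
        rcases eq_or_ne j i with rfl | h
        · refine le_trans (b := (G.laplacian *ᵥ z) j - t * d) (by linarith) ?_
          rw [laplacian_mulVec_apply, Finset.mul_sum, ← Finset.sum_sub_distrib]
          refine Finset.sum_le_sum fun k _ => ?_
          have := G.weight_nonneg j k
          rw [if_pos rfl]
          split_ifs
          · nlinarith
          · linarith
        · refine (hzC.2 j).trans ?_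
          rw [laplacian_mulVec_apply]
          refine Finset.sum_le_sum fun k _ => mul_le_mul_of_nonneg_left ?_ (G.weight_nonneg j k)
          rw [if_neg h]
          split_ifs <;> linarith
    have := hmin _ hy
    rw [Finset.sum_sub_distrib, Finset.sum_ite_eq' Finset.univ i, if_pos (Finset.mem_univ i)] at this
    linarith
  refine ⟨WithLp.toLp 2 z, ⟨hzC.1, fun i => ?_, ?_⟩, ?_⟩
  · have := hzC.2 i
    simp only [PiLp.neg_apply]
    linarith
  · refine Finset.sum_eq_zero fun i _ => ?_
    simp only [PiLp.neg_apply]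
    linarith [hcompl i]
  -- If all coordinates were positive, subtracting the smallest would keep feasibility and reduce
  -- the sum.
  · by_contra! hne
    obtain ⟨i, hi⟩ := Finite.exists_min z
    have hpos : 0 < z i := lt_of_le_of_ne (hzC.1 i) (hne i).symm
    have hy : (fun j => z j + (- z i)) ∈ C := by
      refine ⟨fun j => ?_, fun j => ?_⟩
      · linarith [hi j]
      · rw [laplacian_mulVec_add_const]
        exact hzC.2 j
    have := hmin _ hy
    rw [Finset.sum_add_distrib] at this
    simp at this
    nlinarith

end WeightedDigraph

theorem lcpSol.mul_eq_zero {N : ℕ} {q z : EuclideanSpace ℝ (Fin N)}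
    {M : Matrix (Fin N) (Fin N) ℝ} (hz : z ∈ lcpSol q M) (i : Fin N) :
    z i * (q i + (M *ᵥ z.ofLp) i) = 0 :=
  (Finset.sum_eq_zero_iff_of_nonneg fun i _ => mul_nonneg (hz.1 i) (hz.2.1 i)).1 hz.2.2 i
    (Finset.mem_univ i)

namespace WeightedDigraph

variable {N : ℕ} {G : WeightedDigraph N}

/-- The positive part of the difference of two solutions is controlled by the difference of the
data, provided the larger solution vanishes somewhere. -/
theorem norm_posPart_sub_le {c : ℝ} (hc : 0 < c)
    (hcoer : ∀ x : EuclideanSpace ℝ (Fin N), (∃ i, x i = 0) →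
      c * ‖x‖ ^ 2 ≤ x.ofLp ⬝ᵥ (G.laplacian *ᵥ x.ofLp))
    {u v z w : EuclideanSpace ℝ (Fin N)} (hz : z ∈ lcpSol (-u) G.laplacian)
    (hw : w ∈ lcpSol (-v) G.laplacian) (hz0 : ∃ i, z i = 0) :
    ‖WithLp.toLp 2 fun i => max (z i - w i) 0‖ ≤ c⁻¹ * ‖u - v‖ := by
  set x : EuclideanSpace ℝ (Fin N) := WithLp.toLp 2 fun i => max (z i - w i) 0 with hx
  have hxi : ∀ i, x i = max (z i - w i) 0 := fun i => rfl
  obtain ⟨k, hk⟩ := hz0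
  have h1 := hcoer x ⟨k, by rw [hxi, hk]; simpa using hw.1 k⟩
  have h2 : x.ofLp ⬝ᵥ (G.laplacian *ᵥ x.ofLp) ≤ inner ℝ (u - v) x := by
    rw [PiLp.inner_apply]
    simp only [dotProduct, PiLp.sub_apply, RCLike.inner_apply, conj_trivial]
    refine Finset.sum_le_sum fun i _ => ?_
    rcases le_or_gt (z i - w i) 0 with h | h
    · rw [hxi, max_eq_right h]
      simp
    refine mul_le_mul_of_nonneg_left ?_ (by rw [hxi]; exact le_max_right _ _)
    -- On the support of `x`, complementarity makes row `i` tight for `z`, while `w` satisfies only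
    -- the inequality.
    have hzi : 0 < z i := by linarith [hw.1 i]
    have e1 : (G.laplacian *ᵥ z.ofLp) i = u i := by
      have := (mul_eq_zero.1 (lcpSol.mul_eq_zero hz i)).resolve_left hzi.ne'
      simp only [PiLp.neg_apply] at this
      linarith
    have e2 := hw.2.1 i
    simp only [PiLp.neg_apply] at e2
    -- Here `x i = z i - w i`, and `x j ≥ z j - w j` enters with a nonpositive coefficient for `j ≠
    -- i`.
    have e3 : (G.laplacian *ᵥ x.ofLp) i ≤
        (G.laplacian *ᵥ z.ofLp) i - (G.laplacian *ᵥ w.ofLp) i := by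
      simp only [laplacian_mulVec_apply, ← Finset.sum_sub_distrib, ← mul_sub]
      refine Finset.sum_le_sum fun j _ => mul_le_mul_of_nonneg_left ?_ (G.weight_nonneg i j)
      rw [hxi, hxi, max_eq_left h.le]
      linarith [le_max_left (z j - w j) 0]
    linarith
  have h3 := real_inner_le_norm (u - v) x
  rcases (norm_nonneg x).eq_or_lt with h | h
  · rw [← h]; positivity
  · rw [inv_mul_eq_div, le_div_iff₀ hc]
    nlinarith

/-- The difference of two selected solutions is a difference of two positive parts. Both solutions
have a zero coordinate, so each part is bounded by `c⁻¹` times the distance of the data; hence the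
constant `2 * c⁻¹`. -/
theorem WeightBalanced.exists_isLCPLipschitzConst (hG : G.WeightBalanced)
    (hc : G.StronglyConnected) : ∃ κ : ℝ≥0, 0 < κ ∧ IsLCPLipschitzConst G.laplacian κ := by
  rcases Nat.eq_zero_or_pos N with rfl | hN
  · exact ⟨1, one_pos, id, fun u _ => ⟨fun i => i.elim0, fun i => i.elim0, by simp⟩,
      LipschitzWith.id.lipschitzOnWith⟩
  obtain ⟨c, hc0, hcoer⟩ := hG.exists_coercive hc
  choose! S hS using fun u (hu : ∑ i, u i ≤ 0) => hG.exists_mem_lcpSol hc hN (u := u) hu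
  refine ⟨Real.toNNReal (2 * c⁻¹), by simpa using hc0, S, fun u hu => (hS u hu).1,
    LipschitzOnWith.of_dist_le' fun u hu v hv => ?_⟩
  have h1 := norm_posPart_sub_le hc0 hcoer (hS u hu).1 (hS v hv).1 (hS u hu).2
  have h2 := norm_posPart_sub_le hc0 hcoer (hS v hv).1 (hS u hu).1 (hS v hv).2
  have e : S u - S v = (WithLp.toLp 2 fun i => max (S u i - S v i) 0) -
      WithLp.toLp 2 fun i => max (S v i - S u i) 0 := by
    ext i
    simp only [PiLp.sub_apply]
    rcases le_total (S u i) (S v i) with h | h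
    · rw [max_eq_right (by linarith), max_eq_left (by linarith)]; ring
    · rw [max_eq_left (by linarith), max_eq_right (by linarith)]; ring
  rw [dist_eq_norm, dist_eq_norm, e]
  rw [norm_sub_rev v u] at h2
  refine (norm_sub_le _ _).trans ?_
  linarith

end WeightedDigraph
end

noncomputable section

/-! ### Euclidean projections onto closed convex sets. -/

section Projection

variable {E : Type*} [NormedAddCommGroup E] [InnerProductSpace ℝ E]

theorem norm_sub_le_of_inner_nonpos {x y z : E} (h : inner ℝ (x - y) (z - y) ≤ 0) :
    ‖x - y‖ ≤ ‖x - z‖ := by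
  refine (sq_le_sq₀ (norm_nonneg _) (norm_nonneg _)).1 ?_
  rw [show x - z = (x - y) - (z - y) by abel, norm_sub_sq_real (x - y) (z - y)]
  nlinarith [sq_nonneg ‖z - y‖]

variable [CompleteSpace E] {C : Set E}

theorem metricProj_eq_of_inner_nonpos (hcl : IsClosed C) (hcv : Convex ℝ C) {x y : E}
    (hy : y ∈ C) (h : ∀ z ∈ C, inner ℝ (x - y) (z - y) ≤ 0) : metricProj C x = y :=
  (metricProj_eq_iff ⟨y, hy⟩ hcl hcv x y).2
    ⟨hy, fun z hz => norm_sub_le_of_inner_nonpos (h z hz)⟩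

theorem metricProj_mem (hne : C.Nonempty) (hcl : IsClosed C) (hcv : Convex ℝ C) (x : E) :
    metricProj C x ∈ C :=
  ((metricProj_eq_iff hne hcl hcv x _).1 rfl).1

theorem inner_sub_metricProj_nonpos (hcl : IsClosed C) (hcv : Convex ℝ C) (x : E)
    {z : E} (hz : z ∈ C) : inner ℝ (x - metricProj C x) (z - metricProj C x) ≤ 0 := by
  obtain ⟨w, hw, h⟩ := exists_norm_eq_iInf_of_complete_convex ⟨z, hz⟩ hcl.isComplete hcv x
  have hw' := (norm_eq_iInf_iff_real_inner_le_zero hcv hw).1 h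
  rw [metricProj_eq_of_inner_nonpos hcl hcv hw hw']
  exact hw' z hz

theorem norm_metricProj_sub_le (hne : C.Nonempty) (hcl : IsClosed C) (hcv : Convex ℝ C)
    (x y : E) : ‖metricProj C x - metricProj C y‖ ≤ ‖x - y‖ := by
  have h1 := inner_sub_metricProj_nonpos hcl hcv x (metricProj_mem hne hcl hcv y)
  have h2 := inner_sub_metricProj_nonpos hcl hcv y (metricProj_mem hne hcl hcv x)
  generalize metricProj C x = a at *
  generalize metricProj C y = b at *
  have e : inner ℝ (a - b) (a - b) =
      inner ℝ (x - y) (a - b) + inner ℝ (x - a) (b - a) + inner ℝ (y - b) (a - b) := by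
    simp only [inner_sub_left, inner_sub_right]
    ring
  rw [real_inner_self_eq_norm_sq] at e
  have h3 := real_inner_le_norm (x - y) (a - b)
  rcases (norm_nonneg (a - b)).eq_or_lt with h | h
  · rw [← h]; positivity
  · nlinarith

end Projection

/-! ### Strongly monotone variational inequalities. -/

section VariationalInequality

variable {E : Type*} [NormedAddCommGroup E] [InnerProductSpace ℝ E] [CompleteSpace E]
  {C : Set E} {F : E → E} {m : ℝ}

/-- A strongly monotone Lipschitz map on a closed convex set has a solution of its variational
inequality: the projected gradient step is a contraction. -/
theorem exists_variationalInequality_of_lipschitzOnWith (hne : C.Nonempty) (hcl : IsClosed C)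
    (hcv : Convex ℝ C) (hm : 0 < m)
    (hmono : ∀ x ∈ C, ∀ y ∈ C, m * ‖x - y‖ ^ 2 ≤ inner ℝ (x - y) (F x - F y))
    {κ : ℝ≥0} (hF : LipschitzOnWith κ F C) :
    ∃ x ∈ C, ∀ y ∈ C, 0 ≤ inner ℝ (F x) (y - x) := by
  obtain ⟨l, hl0, hml, hF⟩ : ∃ l : ℝ, 0 < l ∧ m ≤ l ∧
      ∀ x ∈ C, ∀ y ∈ C, ‖F x - F y‖ ≤ l * ‖x - y‖ := by
    refine ⟨max m κ, lt_max_of_lt_left hm, le_max_left _ _, fun x hx y hy => ?_⟩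
    have := hF.dist_le_mul x hx y hy
    rw [dist_eq_norm, dist_eq_norm] at this
    exact this.trans (mul_le_mul_of_nonneg_right (le_max_right _ _) (norm_nonneg _))
  -- This step makes the squared contraction factor `1 - 2 * t * m + t ^ 2 * l ^ 2` equal to `1 - t
  -- * m`; taking `l ≥ m` keeps it nonnegative.
  set t : ℝ := m / l ^ 2 with ht
  have ht0 : 0 < t := by positivity
  have htl : t * l ^ 2 = m := by rw [ht]; field_simp
  have htm : t * m ≤ 1 := by
    rw [ht, div_mul_eq_mul_div, div_le_one (by positivity)]
    nlinarith
  let T : E → E := fun x => metricProj C (x - t • F x)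
  have hT : Set.MapsTo T C C := fun x _ => metricProj_mem hne hcl hcv _
  have hstep : ∀ x ∈ C, ∀ y ∈ C, ‖T x - T y‖ ≤ √(1 - t * m) * ‖x - y‖ := by
    intro x hx y hy
    refine (norm_metricProj_sub_le hne hcl hcv _ _).trans ?_
    rw [← Real.sqrt_sq (norm_nonneg (x - y)), ← Real.sqrt_mul (by linarith)]
    refine Real.le_sqrt_of_sq_le ?_
    rw [show x - t • F x - (y - t • F y) = (x - y) - t • (F x - F y) by module,
      norm_sub_sq_real (x - y), inner_smul_right, norm_smul, Real.norm_of_nonneg ht0.le, mul_pow]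
    have h1 := hmono x hx y hy
    have h2 : ‖F x - F y‖ ^ 2 ≤ l ^ 2 * ‖x - y‖ ^ 2 := by
      rw [← mul_pow]
      exact pow_le_pow_left₀ (norm_nonneg _) (hF x hx y hy) 2
    have h3 : t ^ 2 * ‖F x - F y‖ ^ 2 ≤ t * m * ‖x - y‖ ^ 2 := by
      calc _ ≤ t ^ 2 * (l ^ 2 * ‖x - y‖ ^ 2) := by gcongr
        _ = t * (t * l ^ 2) * ‖x - y‖ ^ 2 := by ring
        _ = _ := by rw [htl]
    have h4 := mul_le_mul_of_nonneg_left h1 ht0.le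
    linarith
  have hcontr : ContractingWith (Real.toNNReal √(1 - t * m)) (hT.restrict T C C) := by
    refine ⟨?_, LipschitzWith.of_dist_le_mul fun x y => ?_⟩
    · rw [Real.toNNReal_lt_one, Real.sqrt_lt' one_pos]
      nlinarith [mul_pos ht0 hm]
    · rw [Subtype.dist_eq, Subtype.dist_eq, dist_eq_norm, dist_eq_norm,
        Real.coe_toNNReal _ (Real.sqrt_nonneg _)]
      exact hstep x x.2 y y.2
  obtain ⟨x₀, hx₀⟩ := hne
  obtain ⟨x, hx, hfix, -⟩ := hcontr.exists_fixedPoint' hcl.isComplete hT hx₀ (edist_ne_top _ _)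
  refine ⟨x, hx, fun y hy => ?_⟩
  have h := inner_sub_metricProj_nonpos hcl hcv (x - t • F x) hy
  have hfix' : metricProj C (x - t • F x) = x := hfix
  rw [hfix', sub_sub_cancel_left, inner_neg_left, inner_smul_left] at h
  simp only [conj_trivial, Left.neg_nonpos_iff] at h
  exact (mul_nonneg_iff_of_pos_left ht0).1 h

/-- It is enough that the map is Lipschitz on bounded parts of the set. -/
theorem exists_variationalInequality (hne : C.Nonempty) (hcl : IsClosed C)
    (hcv : Convex ℝ C) (hm : 0 < m)
    (hmono : ∀ x ∈ C, ∀ y ∈ C, m * ‖x - y‖ ^ 2 ≤ inner ℝ (x - y) (F x - F y))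
    (hF : ∀ (x : E) (r : ℝ), ∃ κ : ℝ≥0, LipschitzOnWith κ F (C ∩ Metric.closedBall x r)) :
    ∃ x ∈ C, ∀ y ∈ C, 0 ≤ inner ℝ (F x) (y - x) := by
  obtain ⟨a, ha⟩ := hne
  -- Strong monotonicity confines the solution on the ball to distance `‖F a‖ / m` from `a`. The
  -- extra `1` leaves room for a short step towards any point of `C`, so the ball constraint is
  -- inactive.
  set r : ℝ := ‖F a‖ / m + 1 with hr
  have hr0 : 0 < r := by positivity
  obtain ⟨κ, hκ⟩ := hF a r
  obtain ⟨x, ⟨hxC, -⟩, hx⟩ := exists_variationalInequality_of_lipschitzOnWith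
    (C := C ∩ Metric.closedBall a r) ⟨a, ha, Metric.mem_closedBall_self hr0.le⟩
    (hcl.inter Metric.isClosed_closedBall) (hcv.inter (convex_closedBall a r)) hm
    (fun x hx y hy => hmono x hx.1 y hy.1) hκ
  have hxa : ‖x - a‖ ≤ ‖F a‖ / m := by
    have h1 := hx a ⟨ha, Metric.mem_closedBall_self hr0.le⟩
    have h2 := hmono x hxC a ha
    have h3 : inner ℝ (x - a) (F x - F a) = - inner ℝ (F x) (a - x) + inner ℝ (F a) (a - x) := by
      rw [real_inner_comm, inner_sub_left, ← neg_sub a x, inner_neg_right, inner_neg_right]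
      ring
    have h4 := real_inner_le_norm (F a) (a - x)
    rw [norm_sub_rev a x] at h4
    rw [le_div_iff₀ hm]
    rcases (norm_nonneg (x - a)).eq_or_lt with h | h
    · rw [← h]; simp
    · nlinarith
  refine ⟨x, hxC, fun y hy => ?_⟩
  obtain ⟨t, ht0, ht1, ht⟩ : ∃ t : ℝ, 0 < t ∧ t ≤ 1 ∧ t * ‖y - x‖ ≤ 1 := by
    refine ⟨1 / (1 + ‖y - x‖), by positivity, ?_, ?_⟩
    · rw [div_le_one (by positivity)]; linarith [norm_nonneg (y - x)]
    · rw [div_mul_eq_mul_div, div_le_one (by positivity)]; linarith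
  have h := hx (x + t • (y - x)) ⟨hcv.add_smul_sub_mem hxC hy ⟨ht0.le, ht1⟩, ?_⟩
  · rw [add_sub_cancel_left, inner_smul_right] at h
    exact (mul_nonneg_iff_of_pos_left ht0).1 h
  · rw [mem_closedBall_iff_norm, add_sub_right_comm]
    refine (norm_add_le _ _).trans ?_
    rw [norm_smul, Real.norm_of_nonneg ht0.le]
    linarith

end VariationalInequality

/-! ### Lagrange multipliers by separation. -/

section LagrangeMultiplier

variable {E : Type*} [AddCommGroup E] [Module ℝ E] {p : ℕ}

/-- Lagrange multipliers for a convex program that satisfies Slater's condition. -/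
theorem exists_lagrange_multiplier {C : Set E} (hC : Convex ℝ C) {φ : E → ℝ}
    (hφ : ConvexOn ℝ C φ) {g : E → Fin p → ℝ} (hg : ∀ k, ConvexOn ℝ C fun x => g x k)
    (hslater : ∃ x ∈ C, ∀ k, g x k < 0) {x : E} (hx : x ∈ C) (hgx : ∀ k, g x k ≤ 0)
    (hmin : ∀ y ∈ C, (∀ k, g y k ≤ 0) → φ x ≤ φ y) :
    ∃ η : Fin p → ℝ, (∀ k, 0 ≤ η k) ∧ (∀ k, η k * g x k = 0) ∧
      ∀ y ∈ C, φ x ≤ φ y + ∑ k, η k * g y k := by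
  -- Strict inequalities make `A` open without any continuity of `g` or `φ`; optimality of `x` keeps
  -- the origin out.
  let A : Set ((Fin p → ℝ) × ℝ) := {q | ∃ y ∈ C, (∀ k, g y k < q.1 k) ∧ φ y - φ x < q.2}
  have hAo : IsOpen A := by
    have : A = ⋃ y ∈ C, (⋂ k, {q | g y k < q.1 k}) ∩ {q | φ y - φ x < q.2} := by
      ext q
      simp [A, and_left_comm]
    rw [this]
    refine isOpen_biUnion fun y _ => IsOpen.inter ?_ (isOpen_lt continuous_const continuous_snd)
    exact isOpen_iInter_of_finite fun k => isOpen_lt continuous_const (by fun_prop)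
  have hAc : Convex ℝ A := by
    rintro ⟨s, t⟩ ⟨y, hy, hy1, hy2⟩ ⟨r, c⟩ ⟨z, hz, hz1, hz2⟩ a b ha hb hab
    have lt_comb : ∀ {r₁ r₂ q₁ q₂ : ℝ}, r₁ < q₁ → r₂ < q₂ → a * r₁ + b * r₂ < a * q₁ + b * q₂ := by
      intro r₁ r₂ q₁ q₂ h1 h2
      rcases ha.eq_or_lt with h | h
      · subst h
        have : b = 1 := by linarith
        subst this
        linarith
      · nlinarith [mul_le_mul_of_nonneg_left h2.le hb, mul_lt_mul_of_pos_left h1 h]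
    refine ⟨a • y + b • z, hC hy hz ha hb hab, fun k => ?_, ?_⟩
    · exact ((hg k).2 hy hz ha hb hab).trans_lt (lt_comb (hy1 k) (hz1 k))
    · have h1 := hφ.2 hy hz ha hb hab
      have h2 := lt_comb hy2 hz2
      simp only [smul_eq_mul] at h1
      have h3 : φ x = a * φ x + b * φ x := by rw [← add_mul, hab, one_mul]
      simp only [Prod.snd_add, Prod.smul_snd, smul_eq_mul]
      linarith
  have hA0 : (0 : (Fin p → ℝ) × ℝ) ∉ A := by
    rintro ⟨y, hy, h1, h2⟩
    have := hmin y hy fun k => (h1 k).le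
    simp only [Prod.snd_zero] at h2
    linarith
  obtain ⟨ℓ, hℓ⟩ := geometric_hahn_banach_point_open hAc hAo hA0
  rw [map_zero] at hℓ
  let w : Fin p → ℝ := fun k => ℓ (Pi.single k 1, 0)
  let τ : ℝ := ℓ (0, 1)
  have hrep : ∀ s t, ℓ (s, t) = ∑ k, w k * s k + τ * t := by
    intro s t
    have e : (s, t) = ∑ k, s k • ((Pi.single k 1 : Fin p → ℝ), (0 : ℝ)) +
        t • ((0 : Fin p → ℝ), (1 : ℝ)) := by
      refine Prod.ext ?_ ?_
      · ext j
        simp [Prod.fst_sum, Finset.sum_apply, Pi.single_apply]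
      · simp [Prod.snd_sum]
    rw [e, map_add, map_sum, map_smul]
    simp only [map_smul, smul_eq_mul, w, τ, mul_comm]
  have hpos : ∀ y ∈ C, ∀ (s : Fin p → ℝ) (t : ℝ), (∀ k, g y k < s k) → φ y - φ x < t →
      0 < ∑ k, w k * s k + τ * t := by
    intro y hy s t hs ht
    rw [← hrep]
    exact hℓ _ ⟨y, hy, hs, ht⟩
  have nonneg_of_forall : ∀ {a b : ℝ}, (∀ c : ℝ, 0 ≤ c → 0 < a + b * c) → 0 ≤ b := by
    intro a b h
    by_contra! hb
    have h1 := h (|a| / (-b)) (div_nonneg (abs_nonneg _) (by linarith))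
    have h2 : b * (|a| / (-b)) = -|a| := by
      rw [div_neg, mul_neg, mul_div_cancel₀ _ hb.ne]
    rw [h2] at h1
    linarith [le_abs_self a]
  have hτ : 0 ≤ τ := by
    refine nonneg_of_forall (a := ∑ k, w k * (g x k + 1) + τ) fun c hc => ?_
    have := hpos x hx (fun k => g x k + 1) (1 + c) (fun k => by linarith) (by linarith)
    linarith
  have hw : ∀ k, 0 ≤ w k := by
    intro k
    refine nonneg_of_forall (a := ∑ k, w k * (g x k + 1) + τ) fun c hc => ?_
    have := hpos x hx (fun j => g x j + 1 + if j = k then c else 0) 1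
      (fun j => by split_ifs <;> linarith) (by linarith)
    simp only [mul_add, Finset.sum_add_distrib, mul_ite, mul_zero, Finset.sum_ite_eq',
      Finset.mem_univ, if_true] at this ⊢
    linarith
  -- With `τ = 0`, the functional would be nonpositive at a point of `A` above the Slater point.
  have hτ0 : 0 < τ := by
    refine hτ.lt_of_ne fun h => ?_
    obtain ⟨y, hy, hgy⟩ := hslater
    have h1 := hpos y hy (fun k => g y k / 2) (φ y - φ x + 1)
      (fun k => by linarith [hgy k]) (by linarith)
    have h2 : ∑ k, w k * (g y k / 2) ≤ 0 :=
      Finset.sum_nonpos fun k _ => mul_nonpos_of_nonneg_of_nonpos (hw k) (by linarith [hgy k])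
    rw [← h] at h1
    linarith
  have hle : ∀ y ∈ C, 0 ≤ ∑ k, w k * g y k + τ * (φ y - φ x) := by
    intro y hy
    refine le_of_forall_pos_lt_add fun δ hδ => ?_
    have hW : 0 < ∑ k, w k + τ := by
      have := Finset.sum_nonneg fun k (_ : k ∈ Finset.univ) => hw k
      linarith
    set e := δ / (∑ k, w k + τ) with he
    have he0 : 0 < e := div_pos hδ hW
    have h1 := hpos y hy (fun k => g y k + e) (φ y - φ x + e) (fun k => by linarith)
      (by linarith)
    simp only [mul_add, Finset.sum_add_distrib, ← Finset.sum_mul] at h1 ⊢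
    have h2 : (∑ k, w k + τ) * e = δ := by rw [he]; field_simp
    linarith
  have hnp : ∀ k, w k * g x k ≤ 0 := fun k =>
    mul_nonpos_of_nonneg_of_nonpos (hw k) (hgx k)
  have hcs : ∀ k, w k * g x k = 0 := by
    have h1 := hle x hx
    rw [sub_self, mul_zero, add_zero] at h1
    intro k
    exact (Finset.sum_eq_zero_iff_of_nonpos fun k _ => hnp k).1
      (le_antisymm (Finset.sum_nonpos fun k _ => hnp k) h1) k (Finset.mem_univ k)
  refine ⟨fun k => w k / τ, fun k => div_nonneg (hw k) hτ, fun k => ?_, fun y hy => ?_⟩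
  · rw [div_mul_eq_mul_div, hcs, zero_div]
  · have h1 := hle y hy
    have h2 : ∑ k, w k / τ * g y k = (∑ k, w k * g y k) / τ := by
      rw [Finset.sum_div]
      exact Finset.sum_congr rfl fun k _ => by ring
    have h3 : φ y - φ x + (∑ k, w k * g y k) / τ =
        (∑ k, w k * g y k + τ * (φ y - φ x)) / τ := by field_simp; ring
    have h4 := div_nonneg h1 hτ
    rw [h2]
    linarith

end LagrangeMultiplier
end

noncomputable section

/-! ### First-order convexity and Lipschitz bounds. -/

section Calculus

variable {E : Type*} [NormedAddCommGroup E] [NormedSpace ℝ E]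

/-- The first-order inequality for a convex function differentiable relative to its domain. -/
theorem ConvexOn.add_hasFDerivWithinAt_le {C : Set E} {φ : E → ℝ} (hφ : ConvexOn ℝ C φ)
    {x y : E} (hx : x ∈ C) (hy : y ∈ C) {φ' : E →L[ℝ] ℝ} (h : HasFDerivWithinAt φ φ' C x) :
    φ x + φ' (y - x) ≤ φ y := by
  have hmaps : Set.MapsTo (AffineMap.lineMap x y : ℝ → E) (Set.Icc 0 1) C := fun t ht =>
    hφ.1.lineMap_mem hx hy ht
  have hconv : ConvexOn ℝ (Set.Icc (0 : ℝ) 1) (φ ∘ (AffineMap.lineMap x y : ℝ →ᵃ[ℝ] E)) :=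
    (hφ.comp_affineMap _).subset hmaps (convex_Icc 0 1)
  have hd : HasDerivWithinAt (φ ∘ (AffineMap.lineMap x y : ℝ →ᵃ[ℝ] E)) (φ' (y - x))
      (Set.Icc 0 1) 0 :=
    HasFDerivWithinAt.comp_hasDerivWithinAt (t := C) 0 (by simpa using h)
      AffineMap.hasDerivWithinAt_lineMap hmaps
  have := hconv.le_slope_of_hasDerivWithinAt (by simp) (by simp) zero_lt_one hd
  rw [slope_def_field] at this
  simp only [Function.comp_apply, AffineMap.lineMap_apply_one, AffineMap.lineMap_apply_zero,
    sub_zero, div_one] at this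
  linarith

end Calculus

section Lipschitz

variable {X : Type*} [PseudoMetricSpace X] {s : Set X}

theorem exists_lipschitzOnWith_toLp {ι : Type*} [Fintype ι] {E : ι → Type*}
    [∀ i, PseudoMetricSpace (E i)] {f : X → ∀ i, E i}
    (h : ∀ i, ∃ κ : ℝ≥0, LipschitzOnWith κ (fun x => f x i) s) :
    ∃ κ : ℝ≥0, LipschitzOnWith κ (fun x => WithLp.toLp 2 (f x) : X → PiLp 2 E) s := by
  choose κ hκ using h
  have hf : LipschitzOnWith (∑ i, κ i) f s := by
    refine LipschitzOnWith.of_dist_le_mul fun x hx y hy => ?_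
    refine (dist_pi_le_iff (by positivity)).2 fun i => ((hκ i).dist_le_mul x hx y hy).trans ?_
    refine mul_le_mul_of_nonneg_right ?_ dist_nonneg
    exact_mod_cast Finset.single_le_sum (f := κ) (fun _ _ => zero_le) (Finset.mem_univ i)
  exact ⟨_, (PiLp.lipschitzWith_toLp 2 E).comp_lipschitzOnWith hf⟩

/-- Product estimate: compactness bounds both factors, each of which is Lipschitz. -/
theorem exists_lipschitzOnWith_clm_apply {E F : Type*} [NormedAddCommGroup E] [NormedSpace ℝ E]
    [NormedAddCommGroup F] [NormedSpace ℝ F] (hs : IsCompact s) {A : X → E →L[ℝ] F} {b : X → E}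
    (hA : ∃ κ : ℝ≥0, LipschitzOnWith κ A s) (hb : ∃ κ : ℝ≥0, LipschitzOnWith κ b s) :
    ∃ κ : ℝ≥0, LipschitzOnWith κ (fun x => A x (b x)) s := by
  obtain ⟨α, hA⟩ := hA
  obtain ⟨β, hb⟩ := hb
  obtain ⟨a, ha⟩ := hs.exists_bound_of_continuousOn hA.continuousOn
  obtain ⟨c, hc⟩ := hs.exists_bound_of_continuousOn hb.continuousOn
  refine ⟨_, LipschitzOnWith.of_dist_le' (K := α * c + a * β) fun x hx y hy => ?_⟩
  have h1 := hA.dist_le_mul x hx y hy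
  have h2 := hb.dist_le_mul x hx y hy
  rw [dist_eq_norm] at h1 h2 ⊢
  have e : A x (b x) - A y (b y) = (A x - A y) (b x) + A y (b x - b y) := by
    simp
  rw [e]
  calc _ ≤ ‖A x - A y‖ * ‖b x‖ + ‖A y‖ * ‖b x - b y‖ :=
        (norm_add_le _ _).trans (add_le_add (ContinuousLinearMap.le_opNorm _ _)
          (ContinuousLinearMap.le_opNorm _ _))
    _ ≤ (α * dist x y) * c + a * (β * dist x y) :=
        add_le_add (mul_le_mul h1 (hc x hx) (norm_nonneg _) (by positivity))
          (mul_le_mul (ha y hy) h2 (norm_nonneg _) ((norm_nonneg _).trans (ha y hy)))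
    _ = _ := by ring

theorem PiLp.lipschitzWith_apply {ι : Type*} [Fintype ι] {E : ι → Type*}
    [∀ i, PseudoMetricSpace (E i)] (i : ι) : LipschitzWith 1 fun x : PiLp 2 E => x i := by
  have h := (LipschitzWith.eval i).comp (PiLp.lipschitzWith_ofLp 2 E)
  rw [one_mul] at h
  exact h

end Lipschitz

/-! ### The reduced variational inequality and the equilibrium. -/

namespace ResourceProblem

variable {N p : ℕ} {n : Fin N → ℕ} (P : ResourceProblem N p n)

/-- The use of the `k`-th resource by all agents. -/
def resourceSlice (x : DecisionSpace n) (k : Fin p) : EuclideanSpace ℝ (Fin N) :=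
  WithLp.toLp 2 fun i => P.g i (x i) k

/-- The multipliers `λ^k = ε S(u^k(x))` given by a selection `S` of LCP solutions. -/
def selectedMultiplier (S : EuclideanSpace ℝ (Fin N) → EuclideanSpace ℝ (Fin N)) (ε : ℝ)
    (x : DecisionSpace n) : MultiplierSpace N p :=
  WithLp.toLp 2 fun i => WithLp.toLp 2 fun k => ε * S (P.resourceSlice x k) i

/-- The map `x ↦ ∇f(x) + v(x, λ(x))` with the selected multipliers `λ(x)`. -/
def selectedField (S : EuclideanSpace ℝ (Fin N) → EuclideanSpace ℝ (Fin N)) (ε : ℝ)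
    (x : DecisionSpace n) : DecisionSpace n :=
  P.gradTotalCost x + P.stackedGradResource x (P.selectedMultiplier S ε x)

/-- The decisions in `Ω` that respect the coupling constraint `g(x) ≤ 0`. -/
def coupledFeasible : Set (DecisionSpace n) :=
  {x | x ∈ P.feasible ∧ ∀ k, P.totalResource x k ≤ 0}

theorem sum_resourceSlice (x : DecisionSpace n) (k : Fin p) :
    ∑ i, P.resourceSlice x k i = P.totalResource x k := by
  simp [resourceSlice, totalResource]

theorem inner_multiplier (l m : MultiplierSpace N p) :
    inner ℝ l m = ∑ k, ∑ i, l i k * m i k := by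
  simp only [PiLp.inner_apply, RCLike.inner_apply, conj_trivial]
  rw [Finset.sum_comm]
  exact Finset.sum_congr rfl fun k _ => Finset.sum_congr rfl fun i _ => mul_comm _ _

theorem norm_stackedResource_sub_sq (x y : DecisionSpace n) :
    ‖P.stackedResource x - P.stackedResource y‖ ^ 2 =
      ∑ k, ‖P.resourceSlice x k - P.resourceSlice y k‖ ^ 2 := by
  rw [← real_inner_self_eq_norm_sq, inner_multiplier]
  refine Finset.sum_congr rfl fun k _ => ?_
  rw [EuclideanSpace.real_norm_sq_eq]
  exact Finset.sum_congr rfl fun i _ => (sq _).symm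

theorem stackedGradResource_add (x : DecisionSpace n) (l m : MultiplierSpace N p) :
    P.stackedGradResource x (l + m) = P.stackedGradResource x l + P.stackedGradResource x m := by
  ext i : 1
  simp [stackedGradResource]

theorem inner_stackedGradResource (x y : DecisionSpace n) (l : MultiplierSpace N p) :
    inner ℝ (P.stackedGradResource x l) y = ∑ i, inner ℝ (l i) (P.jacg i (x i) (y i)) := by
  simp only [PiLp.inner_apply, stackedGradResource, ContinuousLinearMap.adjoint_inner_left]

theorem isClosed_orthant : IsClosed (orthant N p) := by
  have : orthant N p = ⋂ i, ⋂ k, {l | 0 ≤ l i k} := by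
    ext l
    simp [orthant]
  rw [this]
  exact isClosed_iInter fun i => isClosed_iInter fun k =>
    isClosed_le continuous_const (by fun_prop)

theorem convex_orthant : Convex ℝ (orthant N p) := by
  intro l hl m hm a b ha hb _ i k
  simp only [PiLp.add_apply, PiLp.smul_apply, smul_eq_mul]
  exact add_nonneg (mul_nonneg ha (hl i k)) (mul_nonneg hb (hm i k))

theorem bigLaplacian_apply (l : MultiplierSpace N p) (i : Fin N) (k : Fin p) :
    P.bigLaplacian l i k = (P.graph.laplacian *ᵥ fun j => l j k) i := by
  simp [bigLaplacian, Matrix.mulVec, dotProduct]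

/-- The dual flow vanishes at solutions of the complementarity problem. -/
theorem dualFlow_eq_zero {ε : ℝ} (hε : 0 < ε) {x : DecisionSpace n} {l : MultiplierSpace N p}
    (hl : l ∈ orthant N p) (h : ∀ i k, 0 ≤ P.bigLaplacian l i k - ε * P.g i (x i) k)
    (hc : ∀ i k, l i k * (P.bigLaplacian l i k - ε * P.g i (x i) k) = 0) :
    P.dualFlow ε x l = 0 := by
  rw [dualFlow, sub_eq_zero]
  -- The residual at `ε • l` is minus the LCP slack: nonpositive, and orthogonal to `l`.
  refine metricProj_eq_of_inner_nonpos isClosed_orthant convex_orthant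
    (fun i k => mul_nonneg hε.le (hl i k)) fun z hz => ?_
  rw [inner_multiplier]
  refine Finset.sum_nonpos fun k _ => Finset.sum_nonpos fun i _ => ?_
  have h1 := mul_nonneg (h i k) (hz i k)
  have h2 := hc i k
  simp only [PiLp.add_apply, PiLp.sub_apply, PiLp.smul_apply, smul_eq_mul, stackedResource]
  linear_combination h1 + ε * h2

variable {P}

namespace StandingAssumption

variable {μf : ℝ} {κf κg : ℝ≥0}

theorem isClosed_feasible (hP : P.StandingAssumption μf κf κg) : IsClosed P.feasible := by
  have : P.feasible = ⋂ i, (fun x : DecisionSpace n => x i) ⁻¹' P.Ω i := by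
    ext x
    simp [feasible]
  rw [this]
  exact isClosed_iInter fun i => (hP.isClosed_Ω i).preimage (by fun_prop)

theorem convex_feasible (hP : P.StandingAssumption μf κf κg) : Convex ℝ P.feasible :=
  fun _ hx _ hy _ _ ha hb hab i => hP.convex_Ω i (hx i) (hy i) ha hb hab

theorem convexOn_totalResource
    (hP : P.StandingAssumption μf κf κg) (k : Fin p) :
    ConvexOn ℝ P.feasible fun x => P.totalResource x k := by
  refine ⟨hP.convex_feasible, fun x hx y hy a b ha hb hab => ?_⟩
  simp only [← sum_resourceSlice, resourceSlice, smul_eq_mul, Finset.mul_sum,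
    ← Finset.sum_add_distrib]
  exact Finset.sum_le_sum fun i _ => (hP.convex_g i k).2 (hx i) (hy i) ha hb hab

theorem continuousOn_totalResource
    (hP : P.StandingAssumption μf κf κg) (k : Fin p) :
    ContinuousOn (fun x => P.totalResource x k) P.feasible := by
  simp only [← sum_resourceSlice, resourceSlice]
  refine continuousOn_finsetSum _ fun i _ => ?_
  have h : ContinuousOn (fun x : DecisionSpace n => P.g i (x i)) P.feasible :=
    (hP.lipschitz_g i).continuousOn.comp (by fun_prop) fun x hx => hx i
  fun_prop

/-- Each coupling constraint is taken relative to `P.feasible`, where convexity and continuity of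
the resource maps are available. -/
theorem coupledFeasible_eq :
    P.coupledFeasible = P.feasible ∩ ⋂ k, {x ∈ P.feasible | P.totalResource x k ≤ 0} := by
  ext x
  simp only [coupledFeasible, Set.mem_inter_iff, Set.mem_iInter]
  exact ⟨fun h => ⟨h.1, fun k => ⟨h.1, h.2 k⟩⟩, fun h => ⟨h.1, fun k => (h.2 k).2⟩⟩

theorem isClosed_coupledFeasible (hP : P.StandingAssumption μf κf κg) : IsClosed P.coupledFeasible := by
  rw [coupledFeasible_eq]
  exact hP.isClosed_feasible.inter (isClosed_iInter fun k =>
    (hP.continuousOn_totalResource k).preimage_isClosed_of_isClosed hP.isClosed_feasible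
      isClosed_Iic)

theorem convex_coupledFeasible (hP : P.StandingAssumption μf κf κg) : Convex ℝ P.coupledFeasible := by
  rw [coupledFeasible_eq]
  exact hP.convex_feasible.inter (convex_iInter fun k => (hP.convexOn_totalResource k).convex_le 0)

theorem norm_stackedResource_sub_le
    (hP : P.StandingAssumption μf κf κg) {x y : DecisionSpace n} (hx : x ∈ P.feasible)
    (hy : y ∈ P.feasible) :
    ‖P.stackedResource x - P.stackedResource y‖ ^ 2 ≤ κg ^ 2 * ‖x - y‖ ^ 2 := by
  rw [PiLp.norm_sq_eq_of_L2, PiLp.norm_sq_eq_of_L2, Finset.mul_sum]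
  refine Finset.sum_le_sum fun i _ => ?_
  have := (hP.lipschitz_g i).dist_le_mul _ (hx i) _ (hy i)
  rw [dist_eq_norm, dist_eq_norm] at this
  rw [← mul_pow]
  exact pow_le_pow_left₀ (norm_nonneg _) this 2

theorem inner_gradTotalCost_sub
    (hP : P.StandingAssumption μf κf κg) {x y : DecisionSpace n} (hx : x ∈ P.feasible)
    (hy : y ∈ P.feasible) :
    μf * ‖x - y‖ ^ 2 ≤ inner ℝ (x - y) (P.gradTotalCost x - P.gradTotalCost y) := by
  rw [PiLp.norm_sq_eq_of_L2, PiLp.inner_apply, Finset.mul_sum]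
  exact Finset.sum_le_sum fun i _ => hP.stronglyConvex_f i _ (hx i) _ (hy i)

/-- First-order convexity of each component of `g`, weighted by nonnegative multipliers. -/
theorem inner_stackedGradResource_le
    (hP : P.StandingAssumption μf κf κg) {x y : DecisionSpace n} (hx : x ∈ P.feasible)
    (hy : y ∈ P.feasible) {l : MultiplierSpace N p} (hl : l ∈ orthant N p) :
    inner ℝ (P.stackedGradResource x l) (y - x) ≤
      inner ℝ l (P.stackedResource y - P.stackedResource x) := by
  rw [inner_stackedGradResource, PiLp.inner_apply]
  refine Finset.sum_le_sum fun i _ => ?_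
  simp only [PiLp.inner_apply, RCLike.inner_apply, conj_trivial]
  refine Finset.sum_le_sum fun k _ => mul_le_mul_of_nonneg_right ?_ (hl i k)
  have hd := (EuclideanSpace.proj (𝕜 := ℝ) k).hasFDerivAt.comp_hasFDerivWithinAt _
    (hP.hasFDeriv_g i (x i) (hx i))
  exact le_sub_iff_add_le'.2 ((hP.convex_g i k).add_hasFDerivWithinAt_le (hx i) (hy i) hd)

variable {κL : ℝ≥0} {S : EuclideanSpace ℝ (Fin N) → EuclideanSpace ℝ (Fin N)} {ε : ℝ}

theorem resourceSlice_mem {x : DecisionSpace n} (hx : x ∈ P.coupledFeasible) (k : Fin p) :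
    P.resourceSlice x k ∈ {u : EuclideanSpace ℝ (Fin N) | ∑ i, u i ≤ 0} := by
  have := hx.2 k
  rwa [← sum_resourceSlice] at this

theorem selectedMultiplier_mem_orthant
    (hS : ∀ u, ∑ i, u i ≤ 0 → S u ∈ lcpSol (-u) P.graph.laplacian) (hε : 0 < ε) {x : DecisionSpace n}
    (hx : x ∈ P.coupledFeasible) : P.selectedMultiplier S ε x ∈ orthant N p := fun i k =>
  mul_nonneg hε.le ((hS _ (resourceSlice_mem hx k)).1 i)

/-- Cauchy–Schwarz and the Lipschitz bound on `S`, resource by resource. -/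
theorem neg_inner_selectedMultiplier_sub_le
    (hSL : LipschitzOnWith κL S {u | ∑ i, u i ≤ 0}) (hε : 0 < ε) {x y : DecisionSpace n}
    (hx : x ∈ P.coupledFeasible) (hy : y ∈ P.coupledFeasible) :
    -inner ℝ (P.selectedMultiplier S ε x - P.selectedMultiplier S ε y)
        (P.stackedResource x - P.stackedResource y) ≤
      ε * κL * ‖P.stackedResource x - P.stackedResource y‖ ^ 2 := by
  rw [norm_stackedResource_sub_sq, inner_multiplier, ← Finset.sum_neg_distrib, Finset.mul_sum]
  refine Finset.sum_le_sum fun k _ => ?_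
  have e : ∑ i, (P.selectedMultiplier S ε x - P.selectedMultiplier S ε y) i k *
      (P.stackedResource x - P.stackedResource y) i k =
      ε * inner ℝ (S (P.resourceSlice x k) - S (P.resourceSlice y k))
        (P.resourceSlice x k - P.resourceSlice y k) := by
    rw [PiLp.inner_apply, Finset.mul_sum]
    refine Finset.sum_congr rfl fun i _ => ?_
    simp only [selectedMultiplier, stackedResource, resourceSlice, PiLp.sub_apply,
      RCLike.inner_apply, conj_trivial]
    ring
  rw [e]
  have h1 := hSL.dist_le_mul _ (resourceSlice_mem hx k) _ (resourceSlice_mem hy k)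
  rw [dist_eq_norm, dist_eq_norm] at h1
  have h2 := neg_le_of_abs_le (abs_real_inner_le_norm
    (S (P.resourceSlice x k) - S (P.resourceSlice y k)) (P.resourceSlice x k - P.resourceSlice y k))
  have h3 := mul_le_mul_of_nonneg_right h1 (norm_nonneg (P.resourceSlice x k - P.resourceSlice y k))
  have h4 : -inner ℝ (S (P.resourceSlice x k) - S (P.resourceSlice y k))
      (P.resourceSlice x k - P.resourceSlice y k) ≤
      κL * ‖P.resourceSlice x k - P.resourceSlice y k‖ ^ 2 := by linarith
  have := mul_le_mul_of_nonneg_left h4 hε.le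
  linarith

theorem stronglyMonotone_selectedField
    (hP : P.StandingAssumption μf κf κg)
    (hS : ∀ u, ∑ i, u i ≤ 0 → S u ∈ lcpSol (-u) P.graph.laplacian)
    (hSL : LipschitzOnWith κL S {u | ∑ i, u i ≤ 0}) (hε : 0 < ε) {x y : DecisionSpace n}
    (hx : x ∈ P.coupledFeasible) (hy : y ∈ P.coupledFeasible) :
    (μf - ε * κL * κg ^ 2) * ‖x - y‖ ^ 2 ≤
      inner ℝ (x - y) (P.selectedField S ε x - P.selectedField S ε y) := by
  have h1 := hP.inner_gradTotalCost_sub hx.1 hy.1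
  have h2 := hP.inner_stackedGradResource_le hx.1 hy.1 (selectedMultiplier_mem_orthant hS hε hx)
  have h3 := hP.inner_stackedGradResource_le hy.1 hx.1 (selectedMultiplier_mem_orthant hS hε hy)
  have h4 := neg_inner_selectedMultiplier_sub_le hSL hε hx hy
  have h5 := mul_le_mul_of_nonneg_left (hP.norm_stackedResource_sub_le hx.1 hy.1)
    (mul_nonneg hε.le κL.coe_nonneg)
  simp only [selectedField]
  generalize P.selectedMultiplier S ε x = l at *
  generalize P.selectedMultiplier S ε y = m at *
  have e1 : inner ℝ (x - y) (P.gradTotalCost x + P.stackedGradResource x l -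
      (P.gradTotalCost y + P.stackedGradResource y m)) =
      inner ℝ (x - y) (P.gradTotalCost x - P.gradTotalCost y) -
        inner ℝ (P.stackedGradResource x l) (y - x) -
        inner ℝ (P.stackedGradResource y m) (x - y) := by
    rw [real_inner_comm _ (P.stackedGradResource x l),
      real_inner_comm _ (P.stackedGradResource y m)]
    simp only [inner_sub_left, inner_sub_right, inner_add_right]
    ring
  have e2 : inner ℝ (l - m) (P.stackedResource x - P.stackedResource y) =
      -inner ℝ l (P.stackedResource y - P.stackedResource x) -
        inner ℝ m (P.stackedResource x - P.stackedResource y) := by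
    simp only [inner_sub_left, inner_sub_right]
    ring
  rw [e1]
  linarith

/-- Closed bounded sets are compact here, which upgrades the local Lipschitz bound on the Jacobians
to a uniform one and bounds the multipliers they act on. -/
theorem exists_lipschitzOnWith_selectedField
    (hP : P.StandingAssumption μf κf κg)
    (hSL : LipschitzOnWith κL S {u | ∑ i, u i ≤ 0}) (z : DecisionSpace n) (r : ℝ) :
    ∃ κ : ℝ≥0, LipschitzOnWith κ (P.selectedField S ε)
      (P.coupledFeasible ∩ Metric.closedBall z r) := by
  set T := P.coupledFeasible ∩ Metric.closedBall z r
  have hT : IsCompact T := (isCompact_closedBall z r).inter_left hP.isClosed_coupledFeasible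
  have hmaps : ∀ i, Set.MapsTo (fun x : DecisionSpace n => x i) T (P.Ω i) :=
    fun i x hx => hx.1.1 i
  have hproj : ∀ i, LipschitzOnWith 1 (fun x : DecisionSpace n => x i) T :=
    fun i => (PiLp.lipschitzWith_apply i).lipschitzOnWith
  have hslice : ∀ k, ∃ κ : ℝ≥0, LipschitzOnWith κ (fun x => P.resourceSlice x k) T := fun k =>
    exists_lipschitzOnWith_toLp fun i => ⟨_, (PiLp.lipschitzWith_apply k).comp_lipschitzOnWith
      ((hP.lipschitz_g i).comp (hproj i) (hmaps i))⟩
  have hmult : ∀ i, ∃ κ : ℝ≥0, LipschitzOnWith κ (fun x => P.selectedMultiplier S ε x i) T := by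
    refine fun i => exists_lipschitzOnWith_toLp fun k => ?_
    obtain ⟨κ, hκ⟩ := hslice k
    exact ⟨_, (lipschitzWith_smul ε).comp_lipschitzOnWith
      ((PiLp.lipschitzWith_apply i).comp_lipschitzOnWith
        (hSL.comp hκ fun x hx => resourceSlice_mem hx.1 k))⟩
  have hjac : ∀ i, ∃ κ : ℝ≥0, LipschitzOnWith κ
      (fun x => ContinuousLinearMap.adjoint (P.jacg i (x i))) T := by
    intro i
    obtain ⟨κ, hκ⟩ := ((hP.locallyLipschitz_jacg i).mono
      (hmaps i).image_subset).exists_lipschitzOnWith_of_compact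
        (hT.image_of_continuousOn (hproj i).continuousOn)
    exact ⟨_, ContinuousLinearMap.adjoint.lipschitz.comp_lipschitzOnWith
      (hκ.comp (hproj i) (Set.mapsTo_image _ _))⟩
  have hgrad : ∃ κ : ℝ≥0, LipschitzOnWith κ P.gradTotalCost T :=
    exists_lipschitzOnWith_toLp fun i => ⟨_, (hP.lipschitz_gradf i).comp (hproj i) (hmaps i)⟩
  have hres : ∃ κ : ℝ≥0, LipschitzOnWith κ
      (fun x => P.stackedGradResource x (P.selectedMultiplier S ε x)) T :=
    exists_lipschitzOnWith_toLp fun i => exists_lipschitzOnWith_clm_apply hT (hjac i) (hmult i)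
  obtain ⟨κ₁, h₁⟩ := hgrad
  obtain ⟨κ₂, h₂⟩ := hres
  exact ⟨_, h₁.add h₂⟩

/-- A minimizer over `Ω` of a linear function plus the weighted total resource satisfies the
first-order condition. -/
theorem inner_add_stackedGradResource_nonneg
    (hP : P.StandingAssumption μf κf κg) {x q : DecisionSpace n} (hx : x ∈ P.feasible)
    {η : EuclideanSpace ℝ (Fin p)}
    (hmin : ∀ y ∈ P.feasible, inner ℝ q x + inner ℝ η (P.totalResource x) ≤
      inner ℝ q y + inner ℝ η (P.totalResource y)) {y : DecisionSpace n} (hy : y ∈ P.feasible) :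
    0 ≤ inner ℝ (q + P.stackedGradResource x (WithLp.toLp 2 fun _ => η)) (y - x) := by
  have hd : HasFDerivWithinAt (fun y => inner ℝ q y + ∑ i, inner ℝ η (P.g i (y i)))
      (innerSL ℝ q + ∑ i, (innerSL ℝ η).comp ((P.jacg i (x i)).comp
        (PiLp.proj 2 (fun i => EuclideanSpace ℝ (Fin (n i))) i : DecisionSpace n →L[ℝ] _)))
      P.feasible x := by
    refine (innerSL ℝ q).hasFDerivWithinAt.add (HasFDerivWithinAt.fun_sum fun i _ => ?_)
    exact (innerSL ℝ η).hasFDerivAt.comp_hasFDerivWithinAt x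
      ((hP.hasFDeriv_g i (x i) (hx i)).comp x
        (PiLp.proj 2 (fun i => EuclideanSpace ℝ (Fin (n i))) i :
          DecisionSpace n →L[ℝ] _).hasFDerivWithinAt fun y hy => hy i)
  have hloc : IsLocalMinOn (fun y => inner ℝ q y + ∑ i, inner ℝ η (P.g i (y i))) P.feasible x := by
    refine IsMinOn.localize fun y hy => ?_
    have := hmin y hy
    simp only [totalResource, inner_sum] at this
    exact this
  have h := hloc.hasFDerivWithinAt_nonneg hd (sub_mem_posTangentConeAt_of_segment_subset
    (hP.convex_feasible.segment_subset hx hy))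
  rw [inner_add_left, inner_stackedGradResource]
  simpa using h

theorem exists_isEquilibrium
    (hP : P.StandingAssumption μf κf κg) (hκL : IsLCPLipschitzConst P.graph.laplacian κL) (hε : 0 < ε)
    (hεμ : ε * κL * κg ^ 2 < μf) :
    ∃ (x : DecisionSpace n) (l : MultiplierSpace N p), P.IsEquilibrium ε x l := by
  obtain ⟨S, hS, hSL⟩ := hκL
  obtain ⟨a, ha, hag⟩ := hP.slater
  have ha := intrinsicInterior_subset ha
  obtain ⟨x, hx, hVI⟩ := exists_variationalInequality
    (C := P.coupledFeasible) (F := P.selectedField S ε) ⟨a, ha, fun k => (hag k).le⟩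
    hP.isClosed_coupledFeasible hP.convex_coupledFeasible (sub_pos.2 hεμ)
    (fun x hx y hy => hP.stronglyMonotone_selectedField hS hSL hε hx hy)
    (hP.exists_lipschitzOnWith_selectedField hSL)
  -- The variational inequality says that `x` minimizes a linear function, with the field frozen at
  -- `x`, over `coupledFeasible`.
  obtain ⟨η, hη0, hηc, hη⟩ := exists_lagrange_multiplier hP.convex_feasible
    (φ := fun y => inner ℝ (P.selectedField S ε x) y)
    ((innerSL ℝ (P.selectedField S ε x)).toLinearMap.convexOn hP.convex_feasible)
    (g := fun y k => P.totalResource y k) hP.convexOn_totalResource ⟨a, ha, hag⟩ hx.1 hx.2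
    (fun y hy hyg => by
      have := hVI y ⟨hy, hyg⟩
      rw [inner_sub_right] at this
      linarith)
  have hstat := fun y hy => hP.inner_add_stackedGradResource_nonneg (q := P.selectedField S ε x)
    (η := WithLp.toLp 2 η) hx.1 (fun y hy => by
      have := hη y hy
      simp only [PiLp.inner_apply (𝕜 := ℝ) (WithLp.toLp 2 η), RCLike.inner_apply, conj_trivial]
      simp only [mul_comm _ (η _), hηc, Finset.sum_const_zero, add_zero]
      exact this) (y := y) hy
  set l₁ : MultiplierSpace N p := WithLp.toLp 2 fun _ => WithLp.toLp 2 η with hl₁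
  set l := P.selectedMultiplier S ε x + l₁ with hl
  have hlap : ∀ i k, P.bigLaplacian l i k - ε * P.g i (x i) k =
      ε * ((-P.resourceSlice x k) i +
        (P.graph.laplacian *ᵥ (S (P.resourceSlice x k)).ofLp) i) := by
    intro i k
    have e : (fun j => l j k) = fun j => (ε • (S (P.resourceSlice x k)).ofLp) j + η k := rfl
    rw [bigLaplacian_apply, e, WeightedDigraph.laplacian_mulVec_add_const, Matrix.mulVec_smul]
    simp only [Pi.smul_apply, smul_eq_mul, resourceSlice, PiLp.neg_apply]
    ring
  have hsol := fun k => hS _ (resourceSlice_mem hx k)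
  refine ⟨x, l, ?_, ?_⟩
  · rw [primalFlow, sub_eq_zero]
    refine metricProj_eq_of_inner_nonpos hP.isClosed_feasible hP.convex_feasible hx.1
      fun y hy => ?_
    have := hstat y hy
    rw [selectedField, add_assoc, ← stackedGradResource_add] at this
    rw [show x - P.gradTotalCost x - P.stackedGradResource x l - x =
      -(P.gradTotalCost x + P.stackedGradResource x l) by abel, inner_neg_left]
    linarith
  · refine P.dualFlow_eq_zero hε (fun i k => ?_) (fun i k => ?_) fun i k => ?_
    · exact add_nonneg (selectedMultiplier_mem_orthant hS hε hx i k) (hη0 k)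
    · rw [hlap]
      exact mul_nonneg hε.le ((hsol k).2.1 i)
    · rw [hlap]
      have h1 := lcpSol.mul_eq_zero (hsol k) i
      -- If `η k = 0`, complementarity is that of `S`. Otherwise resource `k` is exhausted, so the
      -- nonnegative LCP slacks sum to zero by weight balance and all vanish.
      rcases mul_eq_zero.1 (hηc k) with h | h
      · have : l i k = ε * S (P.resourceSlice x k) i + η k := rfl
        rw [this, h]
        linear_combination ε ^ 2 * h1
      · have h2 : ∑ j, ((-P.resourceSlice x k) j +
            (P.graph.laplacian *ᵥ (S (P.resourceSlice x k)).ofLp) j) = 0 := by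
          rw [Finset.sum_add_distrib, hP.weightBalanced.sum_laplacian_mulVec]
          simp only [PiLp.neg_apply, Finset.sum_neg_distrib, sum_resourceSlice, h]
          simp
        have h3 := (Finset.sum_eq_zero_iff_of_nonneg fun j _ => (hsol k).2.1 j).1 h2 i
          (Finset.mem_univ i)
        rw [h3]
        simp

end StandingAssumption

end ResourceProblem

end

theorem theorem1 {N p : ℕ} {n : Fin N → ℕ} (P : ResourceProblem N p n) (μf : ℝ) (κf κg : ℝ≥0)
    (hP : P.StandingAssumption μf κf κg) :
    (∃ κL : ℝ≥0, 0 < κL ∧ IsLCPLipschitzConst P.graph.laplacian κL) ∧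
      ∀ κL : ℝ≥0, 0 < κL → IsLCPLipschitzConst P.graph.laplacian κL →
        ∀ ε ∈ Set.Ioo (0 : ℝ) (μf / ((κg : ℝ) ^ 2 * (κL : ℝ))),
          ∃ (x : DecisionSpace n) (l : MultiplierSpace N p), P.IsEquilibrium ε x l := by
  refine ⟨hP.weightBalanced.exists_isLCPLipschitzConst hP.stronglyConnected,
    fun κL hκL h ε hε => hP.exists_isEquilibrium h hε.1 ?_⟩
  have hpos : (0 : ℝ) < (κg : ℝ) ^ 2 * κL :=
    mul_pos (pow_pos (by exact_mod_cast hP.κg_pos) 2) (by exact_mod_cast hκL)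
  have := (lt_div_iff₀ hpos).1 hε.2
  linarith
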